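/- Let $n\ge 2$ and let $B$ be the closed unit ball of $\mathbb{R}^n$. For a convex body $K\subset\mathbb{R}^n$ (a nonempty compact convex set) let $S_K$ be its Steiner polynomial, that is, the polynomial with $S_K(t)=\mathrm{vol}(K+tB)$ for all $t\ge 0$, and let $p_K(x)=\sup\{x\cdot v : v\in K\}$ be its support function. Call $K$ a $C^2$ convex body if $p_K$ is twice continuously differentiable on $\mathbb{R}^n\setminus\{0\}$; its principal radii of curvature at $\omega\in S^{n-1}$ are then the eigenvalues of the Hessian of $p_K$ at $\omega$ restricted to the tangent space $\omega^\perp$ of $S^{n-1}$. Assume that, in this $\mathbb{R}^n$, $S_L$ is stable (all its complex roots have negative real part) for every convex body $L\subset\mathbb{R}^n$ with nonempty interior. Let $K\subset\mathbb{R}^n$ be a $C^2$ convex body. Then the principal radii of curvature of $K$, taken over all $\omega\in S^{n-1}$, have a minimum $\rho_{\min}$ and a maximum $\rho_{\max}$, and every complex root $z$ of $S_K$ satisfies $$-\rho_{\max}\le \operatorname{Re} z\le -\rho_{\min}.$$ -/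

import Mathlib

open scoped Pointwise

/-- `P` is the polynomial `t ↦ vol (K + t B)`, `t ≥ 0`, where `B` is the closed Euclidean
unit ball of `ℝⁿ`. -/
def IsSteinerPolynomial {n : ℕ} (K : ConvexBody (EuclideanSpace ℝ (Fin n)))
    (P : Polynomial ℝ) : Prop :=
  ∀ t : ℝ, 0 ≤ t → P.eval t =
    MeasureTheory.volume.real ((K : Set (EuclideanSpace ℝ (Fin n))) +
      t • Metric.closedBall (0 : EuclideanSpace ℝ (Fin n)) 1)

open Classical in
/-- The Steiner polynomial `S_K` of a convex body `K` in `ℝⁿ`: the polynomial with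
`S_K t = vol (K + t B)` for all `t ≥ 0`. (It exists by Steiner's formula; the value `0` is
a mere default.) -/
noncomputable def steinerPolynomial {n : ℕ} (K : ConvexBody (EuclideanSpace ℝ (Fin n))) :
    Polynomial ℝ :=
  if h : ∃ P, IsSteinerPolynomial K P then h.choose else 0

/-- There is at most one Steiner polynomial, so that the choice above is no choice. -/
theorem IsSteinerPolynomial.eq_steinerPolynomial {n : ℕ}
    {K : ConvexBody (EuclideanSpace ℝ (Fin n))} {P : Polynomial ℝ}
    (hP : IsSteinerPolynomial K P) : steinerPolynomial K = P := by
  have h : ∃ P, IsSteinerPolynomial K P := ⟨P, hP⟩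
  have hS : IsSteinerPolynomial K (steinerPolynomial K) := by
    unfold steinerPolynomial
    rw [dif_pos h]
    exact h.choose_spec
  refine Polynomial.eq_of_infinite_eval_eq _ _
    ((Set.Ici_infinite (0 : ℝ)).mono fun t ht => ?_)
  exact (hS t ht).trans (hP t ht).symm

/-- A real polynomial is stable if all its complex roots lie in the open left half-plane. -/
def IsStablePolynomial (P : Polynomial ℝ) : Prop :=
  ∀ z : ℂ, Polynomial.aeval z P = 0 → z.re < 0

/-- The support function `p_K x = sup {x · v | v ∈ K}` of a convex body. -/
noncomputable def supportFn {n : ℕ} (K : ConvexBody (EuclideanSpace ℝ (Fin n)))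
    (x : EuclideanSpace ℝ (Fin n)) : ℝ :=
  sSup ((fun v => inner ℝ x v) '' (K : Set (EuclideanSpace ℝ (Fin n))))

/-- `K` is a `C²` convex body: its support function is twice continuously differentiable
away from the origin (at the origin a positively homogeneous function of degree one is
differentiable only if it is linear). -/
def IsC2Body {n : ℕ} (K : ConvexBody (EuclideanSpace ℝ (Fin n))) : Prop :=
  ContDiffOn ℝ 2 (supportFn K) {0}ᶜ

/-- `r` is a principal radius of curvature of `K` at the unit outer normal `ω`: an
eigenvalue of the Hessian of the support function at `ω`, restricted to the tangent space
`ω^⊥` of the unit sphere. (The gradient of the support function maps `ω` to the boundary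
point of `K` with outer normal `ω`, so that this restricted Hessian is the derivative of the
inverse of the Gauss map of `∂K`.) -/
def IsPrincipalRadius {n : ℕ} (K : ConvexBody (EuclideanSpace ℝ (Fin n)))
    (ω : EuclideanSpace ℝ (Fin n)) (r : ℝ) : Prop :=
  ∃ u : EuclideanSpace ℝ (Fin n), u ≠ 0 ∧ inner ℝ ω u = 0 ∧
    ∀ v : EuclideanSpace ℝ (Fin n), inner ℝ ω v = 0 →
      fderiv ℝ (fderiv ℝ (supportFn K)) ω u v = r * inner ℝ u v

/-- The set of all principal radii of curvature of `K`, over all unit normals. -/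
def principalRadii {n : ℕ} (K : ConvexBody (EuclideanSpace ℝ (Fin n))) : Set ℝ :=
  {r | ∃ ω : EuclideanSpace ℝ (Fin n), ‖ω‖ = 1 ∧ IsPrincipalRadius K ω r}

/-!
Let `h` be the support function of the `C²` body `K`, let `B` be the unit ball, and consider the
radial gradient map `Φ x = ‖x‖ ∇h(x)`, which extends the inverse of the Gauss map to a positively
homogeneous map of degree one, with derivative `A`. For `s > 0` (and `0 ∈ K`) the map
`x ↦ Φ x + s x` is a bijection of `B \ {0}` onto `(K + s B) \ {0}` with positive Jacobian
determinant, so that `vol (K + s B) = ∫_B det (A x + s) dx`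
(`IsC2SupportFunction.measureReal_add_smul_closedBall`). The integral is a polynomial in `s`, which
is therefore the Steiner polynomial of `K`, and in this form it makes sense for all real `s`.

The map `A` depends linearly on `h`, and the norm has `A = id`. If `L` is a body with support
function `a h + c ‖·‖`, where `a = ±1`, this gives `S_L(t) = aⁿ S_K(a (t + c))`
(`steinerPolynomial_eq_comp`). Such a body exists as soon as `a h + c ‖·‖` has positive semidefinite
Hessians in the directions tangent to the sphere (`exists_convexBody_supportFn_eq`), and these
Hessians are `a D²h + c`. So, if all principal radii are at least `ρ`, then for each `r < ρ`
there is a body `L` with `K = L + r B`, whose Steiner polynomial has the roots `z + r`; and if all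
of them are at most `ρ`, then for each `r > ρ` there is a body `M` with `K + M = r B`, whose Steiner
polynomial has the roots `-z - r`. Both bodies have interior points because the inequality between
`r` and `ρ` is strict, so stability applies (`mul_re_le_of_tangential_bound`), and `r → ρ` gives the
two bounds.

The extremal principal radii exist by compactness (`exists_extremal_principalRadius`).
-/

open Set Filter Topology InnerProductSpace MeasureTheory
open scoped Pointwise Gradient

/-! ### Positively homogeneous functions -/

section Homogeneous

variable {E : Type*} [NormedAddCommGroup E] [InnerProductSpace ℝ E]

/-- The derivative of a positively homogeneous map of degree one is positively homogeneous of
degree zero. -/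
theorem fderiv_smul_of_homogeneous {F : Type*} [NormedAddCommGroup F] [NormedSpace ℝ F]
    {f : E → F} (hf : ∀ c : ℝ, 0 < c → ∀ x, f (c • x) = c • f x) {c : ℝ} (hc : 0 < c) (x : E) :
    fderiv ℝ f (c • x) = fderiv ℝ f x := by
  have h1 := fderiv_comp_smul (f := f) (x := x) c
  have h2 : (fun y => f (c • y)) = fun y => c • f y := funext (hf c hc)
  have h3 : fderiv ℝ (fun y => c • f y) x = c • fderiv ℝ f x :=
    congrFun (fderiv_const_smul_field (f := f) c) x
  rw [h2, h3] at h1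
  exact (smul_right_injective _ hc.ne' h1).symm

/-- The derivative of a positively homogeneous map of degree zero is positively homogeneous of
degree minus one. -/
theorem smul_fderiv_smul_of_homogeneous_zero {F : Type*} [NormedAddCommGroup F] [NormedSpace ℝ F]
    {f : E → F} (hf : ∀ c : ℝ, 0 < c → ∀ x, f (c • x) = f x) {c : ℝ} (hc : 0 < c) (x : E) :
    c • fderiv ℝ f (c • x) = fderiv ℝ f x := by
  have h1 := fderiv_comp_smul (f := f) (x := x) c
  rwa [funext (hf c hc), eq_comm] at h1

/-- A positively homogeneous function of degree one that is twice continuously differentiable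
away from the origin. -/
structure IsC2Homogeneous (g : E → ℝ) : Prop where
  contDiffOn : ContDiffOn ℝ 2 g {0}ᶜ
  map_smul : ∀ c : ℝ, 0 < c → ∀ x, g (c • x) = c * g x

theorem isC2Homogeneous_norm : IsC2Homogeneous (fun x : E => ‖x‖) where
  contDiffOn := fun _ hx => (contDiffAt_norm ℝ hx).contDiffWithinAt
  map_smul := fun c hc x => by rw [norm_smul, Real.norm_of_nonneg hc.le]

namespace IsC2Homogeneous

theorem add {f g : E → ℝ} (hf : IsC2Homogeneous f) (hg : IsC2Homogeneous g) :
    IsC2Homogeneous (fun x => f x + g x) where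
  contDiffOn := hf.contDiffOn.add hg.contDiffOn
  map_smul := fun c hc x => by rw [hf.map_smul c hc, hg.map_smul c hc]; ring

theorem const_mul {g : E → ℝ} (hg : IsC2Homogeneous g) (a : ℝ) :
    IsC2Homogeneous (fun x => a * g x) where
  contDiffOn := contDiffOn_const.mul hg.contDiffOn
  map_smul := fun c hc x => by rw [hg.map_smul c hc]; ring

variable {g : E → ℝ}

theorem map_zero (hg : IsC2Homogeneous g) : g 0 = 0 := by
  have := hg.map_smul 2 two_pos 0
  rw [smul_zero] at this
  linarith

theorem contDiffAt (hg : IsC2Homogeneous g) {x : E} (hx : x ≠ 0) : ContDiffAt ℝ 2 g x :=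
  hg.contDiffOn.contDiffAt (isOpen_compl_singleton.mem_nhds hx)

theorem differentiableAt (hg : IsC2Homogeneous g) {x : E} (hx : x ≠ 0) :
    DifferentiableAt ℝ g x :=
  (hg.contDiffAt hx).differentiableAt (by norm_num)

theorem contDiffAt_fderiv (hg : IsC2Homogeneous g) {x : E} (hx : x ≠ 0) :
    ContDiffAt ℝ 1 (fderiv ℝ g) x :=
  (hg.contDiffAt hx).fderiv_right (by norm_num)

theorem differentiableAt_fderiv (hg : IsC2Homogeneous g) {x : E} (hx : x ≠ 0) :
    DifferentiableAt ℝ (fderiv ℝ g) x :=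
  (hg.contDiffAt_fderiv hx).differentiableAt (by norm_num)

theorem fderiv_smul (hg : IsC2Homogeneous g) {c : ℝ} (hc : 0 < c) (x : E) :
    fderiv ℝ g (c • x) = fderiv ℝ g x :=
  fderiv_smul_of_homogeneous hg.map_smul hc x

/-- Euler's identity. -/
theorem fderiv_self (hg : IsC2Homogeneous g) {x : E} (hx : x ≠ 0) : fderiv ℝ g x x = g x := by
  have h1 : HasDerivAt (fun c : ℝ => g (c • x)) (fderiv ℝ g x x) 1 := by
    have h2 : HasDerivAt (fun c : ℝ => c • x) x 1 := by
      simpa using (hasDerivAt_id (1 : ℝ)).smul_const x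
    have h3 : HasFDerivAt g (fderiv ℝ g x) ((1 : ℝ) • x) := by
      rw [one_smul]
      exact (hg.differentiableAt hx).hasFDerivAt
    exact h3.comp_hasDerivAt 1 h2
  have h4 : HasDerivAt (fun c : ℝ => c * g x) (g x) 1 := by
    simpa using (hasDerivAt_id (1 : ℝ)).mul_const (g x)
  refine h1.unique (h4.congr_of_eventuallyEq ?_)
  filter_upwards [lt_mem_nhds (zero_lt_one (α := ℝ))] with c hc using hg.map_smul c hc x

/-- The Hessian annihilates the radial direction in its second argument. -/
theorem fderiv_fderiv_self_right (hg : IsC2Homogeneous g) {x : E} (hx : x ≠ 0) (v : E) :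
    fderiv ℝ (fderiv ℝ g) x v x = 0 := by
  have h1 : HasFDerivAt (fun y => fderiv ℝ g y y) _ x :=
    (hg.differentiableAt_fderiv hx).hasFDerivAt.clm_apply (hasFDerivAt_id x)
  have h2 : HasFDerivAt (fun y => fderiv ℝ g y y) (fderiv ℝ g x) x := by
    refine (hg.differentiableAt hx).hasFDerivAt.congr_of_eventuallyEq ?_
    filter_upwards [isOpen_compl_singleton.mem_nhds hx] with y hy using hg.fderiv_self hy
  have h3 := congrArg (fun T : E →L[ℝ] ℝ => T v) (h1.unique h2)
  simpa using h3

/-- The Hessian annihilates the radial direction in its first argument. -/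
theorem fderiv_fderiv_self_left (hg : IsC2Homogeneous g) {x : E} (hx : x ≠ 0) :
    fderiv ℝ (fderiv ℝ g) x x = 0 := by
  have h1 : HasDerivAt (fun c : ℝ => fderiv ℝ g (c • x)) (fderiv ℝ (fderiv ℝ g) x x) 1 := by
    have h2 : HasDerivAt (fun c : ℝ => c • x) x 1 := by
      simpa using (hasDerivAt_id (1 : ℝ)).smul_const x
    have h3 : HasFDerivAt (fderiv ℝ g) (fderiv ℝ (fderiv ℝ g) x) ((1 : ℝ) • x) := by
      rw [one_smul]
      exact (hg.differentiableAt_fderiv hx).hasFDerivAt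
    exact h3.comp_hasDerivAt 1 h2
  refine h1.unique ((hasDerivAt_const (1 : ℝ) (fderiv ℝ g x)).congr_of_eventuallyEq ?_)
  filter_upwards [lt_mem_nhds (zero_lt_one (α := ℝ))] with c hc using hg.fderiv_smul hc x

/-- A Hessian that is positive semidefinite on the tangent spaces of the unit sphere is positive
semidefinite in all directions at all points other than the origin. -/
theorem fderiv_fderiv_nonneg_of_tangential (hg : IsC2Homogeneous g)
    (htan : ∀ ω u : E, ‖ω‖ = 1 → inner ℝ ω u = 0 → 0 ≤ fderiv ℝ (fderiv ℝ g) ω u u)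
    {x : E} (hx : x ≠ 0) (w : E) : 0 ≤ fderiv ℝ (fderiv ℝ g) x w w := by
  have hpos : 0 < ‖x‖ := norm_pos_iff.2 hx
  set ω : E := ‖x‖⁻¹ • x with hω
  have hω1 : ‖ω‖ = 1 := norm_smul_inv_norm hx
  have hω0 : ω ≠ 0 := by
    intro h
    rw [h, norm_zero] at hω1
    exact zero_ne_one hω1
  have hx' : fderiv ℝ (fderiv ℝ g) x = ‖x‖⁻¹ • fderiv ℝ (fderiv ℝ g) ω :=
    (smul_fderiv_smul_of_homogeneous_zero
      (fun c hc y => hg.fderiv_smul hc y) (inv_pos.2 hpos) x).symm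
  set a : ℝ := inner ℝ ω w
  have hu : inner ℝ ω (w - a • ω) = 0 := by
    rw [inner_sub_right, inner_smul_right, real_inner_self_eq_norm_sq, hω1]
    simp [a]
  have h1 := htan ω (w - a • ω) hω1 hu
  have hl := hg.fderiv_fderiv_self_left hω0
  have h2 : fderiv ℝ (fderiv ℝ g) ω (w - a • ω) (w - a • ω) = fderiv ℝ (fderiv ℝ g) ω w w := by
    simp [hl, hg.fderiv_fderiv_self_right hω0]
  rw [hx']
  simp only [smul_apply, smul_eq_mul]
  rw [← h2]
  positivity

/-- Tangent planes lie below the graph, when the segment to the other point avoids the origin. -/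
theorem fderiv_apply_le_of_notMem_span (hg : IsC2Homogeneous g)
    (hess : ∀ x : E, x ≠ 0 → ∀ w, 0 ≤ fderiv ℝ (fderiv ℝ g) x w w)
    {x y : E} (hx : x ≠ 0) (hy : y ∉ Submodule.span ℝ {x}) : fderiv ℝ g x y ≤ g y := by
  set w : E := y - x with hw
  have hp : ∀ t : ℝ, x + t • w ≠ 0 := by
    intro t ht
    rcases eq_or_ne t 0 with rfl | h0
    · exact hx (by simpa using ht)
    · refine hy (Submodule.mem_span_singleton.2 ⟨(t - 1) / t, ?_⟩)
      have h2 : t • y = (t - 1) • x := by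
        rw [hw, smul_sub] at ht
        rw [sub_smul, one_smul, ← sub_eq_zero, ← ht]
        abel
      rw [div_eq_inv_mul, mul_smul, ← h2, inv_smul_smul₀ h0]
  have hline : ∀ t : ℝ, HasDerivAt (fun t : ℝ => x + t • w) w t := fun t => by
    simpa using ((hasDerivAt_id t).smul_const w).const_add x
  have h1 : ∀ t : ℝ, HasDerivAt (fun t : ℝ => g (x + t • w)) (fderiv ℝ g (x + t • w) w) t :=
    fun t => (hg.differentiableAt (hp t)).hasFDerivAt.comp_hasDerivAt t (hline t)
  have h2 : ∀ t : ℝ, HasDerivAt (fun t : ℝ => fderiv ℝ g (x + t • w) w)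
      (fderiv ℝ (fderiv ℝ g) (x + t • w) w w) t := fun t => by
    exact (ContinuousLinearMap.apply ℝ ℝ w).hasFDerivAt.comp_hasDerivAt t
      ((hg.differentiableAt_fderiv (hp t)).hasFDerivAt.comp_hasDerivAt t (hline t))
  have hmono : Monotone fun t : ℝ => fderiv ℝ g (x + t • w) w :=
    monotone_of_deriv_nonneg (fun t => (h2 t).differentiableAt)
      fun t => by rw [(h2 t).deriv]; exact hess _ (hp t) w
  obtain ⟨t, ht, hmv⟩ := exists_hasDerivAt_eq_slope (fun t : ℝ => g (x + t • w)) _ zero_lt_one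
    (fun t _ => (h1 t).continuousAt.continuousWithinAt) fun t _ => h1 t
  have h3 : fderiv ℝ g x w ≤ g y - g x := by
    have := hmono ht.1.le
    simp only [zero_smul, add_zero] at this
    rw [hmv] at this
    simpa [hw] using this
  rw [hw, _root_.map_sub, hg.fderiv_self hx] at h3
  linarith

/-- In dimension at least two, a homogeneous function whose Hessian is positive semidefinite on
the tangent spaces of the unit sphere is convex: its tangent planes lie below its graph. Points
`y` on the line through `x`, where the segment from `x` to `y` may meet the singularity at the
origin, are reached by approximation. -/
theorem fderiv_apply_le_of_tangential (hg : IsC2Homogeneous g) (hdim : 1 < Module.finrank ℝ E)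
    (htan : ∀ ω u : E, ‖ω‖ = 1 → inner ℝ ω u = 0 → 0 ≤ fderiv ℝ (fderiv ℝ g) ω u u)
    {x : E} (hx : x ≠ 0) (y : E) : fderiv ℝ g x y ≤ g y := by
  have hess := fun z hz => hg.fderiv_fderiv_nonneg_of_tangential htan (x := z) hz
  rcases eq_or_ne y 0 with rfl | hy
  · simp [hg.map_zero]
  by_contra! hlt
  have hopen : ∀ᶠ z in 𝓝 y, g z < fderiv ℝ g x z :=
    (hg.contDiffAt hy).continuousAt.eventually_lt (fderiv ℝ g x).continuous.continuousAt hlt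
  have hdense : Dense ((Submodule.span ℝ {x} : Set E)ᶜ) := by
    rw [← interior_eq_empty_iff_dense_compl]
    by_contra hne
    have htop := Submodule.eq_top_of_nonempty_interior' _ (nonempty_iff_ne_empty.2 hne)
    have := finrank_span_le_card (R := ℝ) ({x} : Set E)
    rw [htop, finrank_top] at this
    simp at this
    omega
  obtain ⟨z, hz, hzx⟩ := hdense.inter_nhds_nonempty hopen
  exact absurd (hg.fderiv_apply_le_of_notMem_span hess hx hz) (not_le.2 hzx)

end IsC2Homogeneous

end Homogeneous

/-! ### The radial gradient map -/

section RadialGradient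

variable {E : Type*} [NormedAddCommGroup E] [InnerProductSpace ℝ E]

theorem fderiv_norm_apply {x : E} (hx : x ≠ 0) (v : E) :
    fderiv ℝ (fun y : E => ‖y‖) x v = inner ℝ x v / ‖x‖ := by
  have hpos : 0 < ‖x‖ := norm_pos_iff.2 hx
  have h1 : HasFDerivAt (fun y : E => ‖y‖) (fderiv ℝ (fun y : E => ‖y‖) x) x :=
    (isC2Homogeneous_norm.differentiableAt hx).hasFDerivAt
  have h2 := congrArg (fun T : E →L[ℝ] ℝ => T v)
    ((h1.pow 2).unique (hasStrictFDerivAt_norm_sq x).hasFDerivAt)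
  simp at h2
  field_simp
  linarith

variable [FiniteDimensional ℝ E]

/-- The homogeneous extension of degree one, `x ↦ ‖x‖ ∇g(x)`, of the restriction of the gradient
of `g` to the unit sphere. If `g` is the support function of a convex body, this map sends the
unit sphere to the boundary of the body (it is the inverse of the Gauss map). -/
noncomputable def radialGradient (g : E → ℝ) (x : E) : E := ‖x‖ • ∇ g x

namespace IsC2Homogeneous

variable {g : E → ℝ}

theorem inner_radialGradient (g : E → ℝ) (x w : E) :
    inner ℝ w (radialGradient g x) = ‖x‖ * fderiv ℝ g x w := by
  rw [radialGradient, inner_smul_right, real_inner_comm, inner_gradient_left]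

theorem radialGradient_smul (hg : IsC2Homogeneous g) (c : ℝ) (hc : 0 < c) (x : E) :
    radialGradient g (c • x) = c • radialGradient g x := by
  rw [radialGradient, radialGradient, gradient, hg.fderiv_smul hc, norm_smul,
    Real.norm_of_nonneg hc.le, mul_smul, gradient]

theorem contDiffAt_radialGradient (hg : IsC2Homogeneous g) {x : E} (hx : x ≠ 0) :
    ContDiffAt ℝ 1 (radialGradient g) x := by
  let J : (E →L[ℝ] ℝ) →ₗ[ℝ] E :=
    { toFun := fun φ => (toDual ℝ E).symm φ
      map_add' := by simp
      map_smul' := by simp }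
  have h : ContDiffAt ℝ 1 (fun y => LinearMap.toContinuousLinearMap J (fderiv ℝ g y)) x :=
    (LinearMap.toContinuousLinearMap J).contDiff.contDiffAt.comp x (hg.contDiffAt_fderiv hx)
  exact (contDiffAt_norm ℝ hx).smul h

theorem hasFDerivAt_radialGradient (hg : IsC2Homogeneous g) {x : E} (hx : x ≠ 0) :
    HasFDerivAt (radialGradient g) (fderiv ℝ (radialGradient g) x) x :=
  ((hg.contDiffAt_radialGradient hx).differentiableAt one_ne_zero).hasFDerivAt

theorem fderiv_radialGradient_smul (hg : IsC2Homogeneous g) {c : ℝ} (hc : 0 < c) (x : E) :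
    fderiv ℝ (radialGradient g) (c • x) = fderiv ℝ (radialGradient g) x :=
  fderiv_smul_of_homogeneous hg.radialGradient_smul hc x

theorem continuousOn_fderiv_radialGradient (hg : IsC2Homogeneous g) :
    ContinuousOn (fderiv ℝ (radialGradient g)) {0}ᶜ :=
  ContDiffOn.continuousOn_fderiv_of_isOpen
    (fun _ hx => (hg.contDiffAt_radialGradient hx).contDiffWithinAt) isOpen_compl_singleton le_rfl

/-- The derivative of the radial gradient map: the Hessian of `g` in tangential directions, and the
gradient in the radial direction. -/
theorem inner_fderiv_radialGradient (hg : IsC2Homogeneous g) {x : E} (hx : x ≠ 0) (v w : E) :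
    inner ℝ w (fderiv ℝ (radialGradient g) x v) =
      ‖x‖ * fderiv ℝ (fderiv ℝ g) x v w + inner ℝ x v / ‖x‖ * fderiv ℝ g x w := by
  have h1 : HasFDerivAt (fun y => inner ℝ w (radialGradient g y))
      ((innerSL ℝ w).comp (fderiv ℝ (radialGradient g) x)) x :=
    (innerSL ℝ w).hasFDerivAt.comp x (hg.hasFDerivAt_radialGradient hx)
  have h2 : HasFDerivAt (fun y => fderiv ℝ g y w)
      ((ContinuousLinearMap.apply ℝ ℝ w).comp (fderiv ℝ (fderiv ℝ g) x)) x :=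
    (ContinuousLinearMap.apply ℝ ℝ w).hasFDerivAt.comp x
      (hg.differentiableAt_fderiv hx).hasFDerivAt
  have h3 := (isC2Homogeneous_norm.differentiableAt hx).hasFDerivAt.mul h2
  simp only [inner_radialGradient] at h1
  have h4 := congrArg (fun T : E →L[ℝ] ℝ => T v) (h1.unique h3)
  simp [fderiv_norm_apply hx] at h4
  rw [h4]
  ring

theorem gradient_combination (hg : IsC2Homogeneous g) (a c : ℝ) {x : E} (hx : x ≠ 0) :
    ∇ (fun y => a * g y + c * ‖y‖) x = a • ∇ g x + (c * ‖x‖⁻¹) • x := by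
  refine ext_inner_right ℝ fun v => ?_
  have h := ((hg.differentiableAt hx).hasFDerivAt.const_mul a).add
    ((isC2Homogeneous_norm.differentiableAt hx).hasFDerivAt.const_mul c)
  have h' : fderiv ℝ (fun y => a * g y + c * ‖y‖) x = _ := h.fderiv
  rw [inner_gradient_left, h', inner_add_left, real_inner_smul_left, real_inner_smul_left,
    inner_gradient_left]
  simp only [_root_.add_apply, _root_.smul_apply, smul_eq_mul, fderiv_norm_apply hx]
  ring

theorem radialGradient_combination (hg : IsC2Homogeneous g) (a c : ℝ) {x : E} (hx : x ≠ 0) :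
    radialGradient (fun y => a * g y + c * ‖y‖) x = a • radialGradient g x + c • x := by
  have hpos : ‖x‖ ≠ 0 := norm_ne_zero_iff.2 hx
  rw [radialGradient, radialGradient, hg.gradient_combination a c hx, smul_add, smul_comm,
    smul_smul ‖x‖ (c * ‖x‖⁻¹), show ‖x‖ * (c * ‖x‖⁻¹) = c by field_simp]

theorem fderiv_radialGradient_combination (hg : IsC2Homogeneous g) (a c : ℝ) {x : E}
    (hx : x ≠ 0) :
    fderiv ℝ (radialGradient fun y => a * g y + c * ‖y‖) x =
      a • fderiv ℝ (radialGradient g) x + c • ContinuousLinearMap.id ℝ E := by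
  have h := ((hg.hasFDerivAt_radialGradient hx).const_smul a).add ((hasFDerivAt_id x).const_smul c)
  refine (h.congr_of_eventuallyEq ?_).fderiv
  filter_upwards [isOpen_compl_singleton.mem_nhds hx] with y hy
  simpa using hg.radialGradient_combination a c hy

/-- The Hessian of `a g + c ‖·‖` in directions tangent to the unit sphere. -/
theorem fderiv_fderiv_combination (hg : IsC2Homogeneous g) (a c : ℝ) {ω u v : E}
    (hω : ‖ω‖ = 1) (hu : inner ℝ ω u = 0) :
    fderiv ℝ (fderiv ℝ fun y => a * g y + c * ‖y‖) ω u v =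
      a * fderiv ℝ (fderiv ℝ g) ω u v + c * inner ℝ u v := by
  have hω0 : ω ≠ 0 := by
    rintro rfl
    simp at hω
  have h := ((hg.const_mul a).add (isC2Homogeneous_norm.const_mul c)).inner_fderiv_radialGradient
    hω0 u v
  have h' := hg.inner_fderiv_radialGradient hω0 u v
  rw [hg.fderiv_radialGradient_combination a c hω0] at h
  simp only [hω, hu, _root_.add_apply, _root_.smul_apply, inner_add_right, inner_smul_right,
    ContinuousLinearMap.id_apply, one_mul, zero_div, zero_mul, add_zero] at h h'
  rw [← h, h', real_inner_comm]

end IsC2Homogeneous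

end RadialGradient

/-! ### Twice differentiable support functions -/

/-- An endomorphism without eigenvalue in `(-∞, 0]` has positive determinant: it can be deformed
to the identity through invertible endomorphisms. -/
theorem ContinuousLinearMap.det_pos_of_forall_add_smul_ne_zero {E : Type*} [NormedAddCommGroup E]
    [NormedSpace ℝ E] [FiniteDimensional ℝ E] (T : E →L[ℝ] E)
    (hT : ∀ (v : E) (c : ℝ), 0 ≤ c → T v + c • v = 0 → v = 0) : 0 < T.det := by
  let f : ℝ → ℝ := fun τ => (τ • T + (1 - τ) • ContinuousLinearMap.id ℝ E).det
  have hf : Continuous f := ContinuousLinearMap.continuous_det.comp (by fun_prop)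
  have hf0 : f 0 = 1 := by simp [f, ContinuousLinearMap.det]
  have hf1 : f 1 = T.det := by simp [f]
  have hne : ∀ τ ∈ Icc (0 : ℝ) 1, f τ ≠ 0 := by
    intro τ hτ h0
    rcases eq_or_lt_of_le hτ.1 with rfl | hpos
    · exact one_ne_zero (hf0.symm.trans h0)
    obtain ⟨v, hv, hv0⟩ := (Submodule.ne_bot_iff _).1 (LinearMap.bot_lt_ker_of_det_eq_zero h0).ne'
    refine hv0 (hT v (τ⁻¹ * (1 - τ)) (mul_nonneg (inv_nonneg.2 hpos.le) (by linarith [hτ.2])) ?_)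
    have h1 : τ • T v + (1 - τ) • v = 0 := by simpa using hv
    have h2 := congrArg (fun w => τ⁻¹ • w) h1
    simpa [smul_add, smul_smul, hpos.ne'] using h2
  rw [← hf1]
  by_contra! hle
  obtain ⟨τ, hτ, h0⟩ := intermediate_value_Icc' zero_le_one hf.continuousOn
    (show (0 : ℝ) ∈ Icc (f 1) (f 0) from ⟨hle, hf0 ▸ zero_le_one⟩)
  exact hne τ hτ h0

theorem ContinuousLinearMap.det_add_smul_id_eq_eval_charpoly {E : Type*} [NormedAddCommGroup E]
    [NormedSpace ℝ E] [FiniteDimensional ℝ E] (T : E →L[ℝ] E) (s : ℝ) :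
    (T + s • ContinuousLinearMap.id ℝ E).det = (-(T : E →ₗ[ℝ] E)).charpoly.eval s := by
  rw [LinearMap.eval_charpoly, ContinuousLinearMap.det]
  congr 1
  ext v
  simp [add_comm]

/-- `g` is the support function of the set `K`, and is twice continuously differentiable away from
the origin. That `g` is not larger than the support function is expressed by its gradients being
points of `K`. -/
structure IsC2SupportFunction {E : Type*} [NormedAddCommGroup E] [InnerProductSpace ℝ E]
    [CompleteSpace E] (g : E → ℝ) (K : Set E) : Prop extends IsC2Homogeneous g where
  inner_le : ∀ v ∈ K, ∀ y, inner ℝ y v ≤ g y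
  gradient_mem : ∀ x, x ≠ 0 → ∇ g x ∈ K

namespace IsC2SupportFunction

variable {E : Type*} [NormedAddCommGroup E] [InnerProductSpace ℝ E] [FiniteDimensional ℝ E]
  {g : E → ℝ} {K : Set E}

theorem fderiv_le (hg : IsC2SupportFunction g K) {x : E} (hx : x ≠ 0) (y : E) :
    fderiv ℝ g x y ≤ g y := by
  rw [← inner_gradient_left, real_inner_comm]
  exact hg.inner_le _ (hg.gradient_mem x hx) y

theorem add_mul_norm_pos (hg : IsC2SupportFunction g K) {s : ℝ} {k : E} (hk : k ∈ K)
    (hks : ‖k‖ < s) {x : E} (hx : x ≠ 0) : 0 < g x + s * ‖x‖ := by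
  have h1 := hg.inner_le k hk x
  have h2 := (abs_le.1 (abs_real_inner_le_norm x k)).1
  have h3 : 0 < ‖x‖ := norm_pos_iff.2 hx
  nlinarith

theorem fderiv_fderiv_nonneg (hg : IsC2SupportFunction g K) {x : E} (hx : x ≠ 0) (v : E) :
    0 ≤ fderiv ℝ (fderiv ℝ g) x v v := by
  have hline : HasDerivAt (fun t : ℝ => x + t • v) v 0 := by
    simpa using ((hasDerivAt_id (0 : ℝ)).smul_const v).const_add x
  have h1 : HasFDerivAt (fderiv ℝ g) (fderiv ℝ (fderiv ℝ g) x) (x + (0 : ℝ) • v) := by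
    simpa using (hg.differentiableAt_fderiv hx).hasFDerivAt
  have h2 : HasDerivAt (fun t : ℝ => fderiv ℝ g (x + t • v) v)
      (fderiv ℝ (fderiv ℝ g) x v v) 0 :=
    (ContinuousLinearMap.apply ℝ ℝ v).hasFDerivAt.comp_hasDerivAt 0
      (h1.comp_hasDerivAt 0 hline)
  refine ge_of_tendsto (hasDerivAt_iff_tendsto_slope.1 h2) ?_
  have hev : ∀ᶠ t : ℝ in 𝓝 0, x + t • v ≠ 0 :=
    hline.continuousAt.eventually_ne (by simpa using hx)
  filter_upwards [nhdsWithin_le_nhds hev, self_mem_nhdsWithin] with t ht ht0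
  -- Monotonicity of the gradient, from the two tangent plane inequalities.
  have h3 : 0 ≤ t * (fderiv ℝ g (x + t • v) v - fderiv ℝ g x v) := by
    have ha := hg.fderiv_le hx (x + t • v)
    have hb := hg.fderiv_le ht x
    rw [← hg.fderiv_self ht] at ha
    rw [← hg.fderiv_self hx] at hb
    simp only [map_add, map_smul, smul_eq_mul] at ha hb
    linarith
  have ht2 : 0 < t ^ 2 := by
    have : t ≠ 0 := ht0
    positivity
  rw [slope_def_field]
  simp only [sub_zero, zero_smul, add_zero]
  have h4 : (fderiv ℝ g (x + t • v) v - fderiv ℝ g x v) / t =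
      t * (fderiv ℝ g (x + t • v) v - fderiv ℝ g x v) / t ^ 2 := by
    have : t ≠ 0 := ht0
    field_simp
  rw [h4]
  positivity

/-- The Jacobian determinant of `x ↦ ‖x‖ ∇g(x) + s x` is positive. -/
theorem det_fderiv_radialGradient_pos (hg : IsC2SupportFunction g K) {s : ℝ} (hs : 0 < s) {x : E}
    (hx : x ≠ 0) (hpos : 0 < g x + s * ‖x‖) :
    0 < (fderiv ℝ (radialGradient g) x + s • ContinuousLinearMap.id ℝ E).det := by
  refine ContinuousLinearMap.det_pos_of_forall_add_smul_ne_zero _ fun v c hc hv => ?_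
  have hx0 : 0 < ‖x‖ := norm_pos_iff.2 hx
  have key : ∀ w : E, ‖x‖ * fderiv ℝ (fderiv ℝ g) x v w + inner ℝ x v / ‖x‖ * fderiv ℝ g x w +
      (s + c) * inner ℝ w v = 0 := by
    intro w
    rw [← hg.inner_fderiv_radialGradient hx, ← inner_smul_right, ← inner_add_right]
    have : fderiv ℝ (radialGradient g) x v + (s + c) • v = 0 := by
      rw [← hv, add_smul]
      simp [add_assoc]
    rw [this, inner_zero_right]
  have h0 : inner ℝ x v = 0 := by
    have h := key x
    rw [hg.fderiv_fderiv_self_right hx, hg.fderiv_self hx] at h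
    have h' : inner ℝ x v * ((g x + s * ‖x‖) + c * ‖x‖) = 0 := by
      field_simp at h
      linarith
    exact (mul_eq_zero.1 h').resolve_right (by positivity)
  have h := key v
  rw [h0, zero_div, zero_mul, add_zero, real_inner_self_eq_norm_sq] at h
  have h2 := hg.fderiv_fderiv_nonneg hx v
  have h3 : (s + c) * ‖v‖ ^ 2 ≤ 0 := by nlinarith [mul_nonneg hx0.le h2]
  have h4 : ‖v‖ ^ 2 ≤ 0 := by
    by_contra! h5
    have : 0 < (s + c) * ‖v‖ ^ 2 := by positivity
    linarith
  exact norm_eq_zero.1 (pow_eq_zero_iff two_ne_zero |>.1 (le_antisymm h4 (sq_nonneg _)))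

theorem injOn_radialGradient_add_smul (hg : IsC2SupportFunction g K) {s : ℝ} (hs : 0 < s)
    (hpos : ∀ x, x ≠ 0 → 0 < g x + s * ‖x‖) :
    InjOn (fun x => radialGradient g x + s • x) {0}ᶜ := by
  have hle : ∀ x, x ≠ 0 → ∀ y, y ≠ 0 → radialGradient g x + s • x = radialGradient g y + s • y →
      ‖x‖ ≤ ‖y‖ := by
    intro x hx y hy h
    have hx0 : 0 < ‖x‖ := norm_pos_iff.2 hx
    have h1 := congrArg (inner ℝ x) h
    simp only [inner_add_right, inner_smul_right, IsC2Homogeneous.inner_radialGradient,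
      hg.fderiv_self hx, real_inner_self_eq_norm_sq] at h1
    have h2 := mul_le_mul_of_nonneg_left (hg.fderiv_le hy x) (norm_nonneg y)
    have h3 := mul_le_mul_of_nonneg_left (real_inner_le_norm x y) hs.le
    have h4 : ‖x‖ * (g x + s * ‖x‖) ≤ ‖y‖ * (g x + s * ‖x‖) := by nlinarith
    exact le_of_mul_le_mul_right h4 (hpos x hx)
  intro x hx y hy h
  have hn : ‖x‖ = ‖y‖ := le_antisymm (hle x hx y hy h) (hle y hy x hx h.symm)
  have h1 := congrArg (inner ℝ (x - y)) h
  simp only [inner_add_right, inner_smul_right, IsC2Homogeneous.inner_radialGradient, hn,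
    _root_.map_sub, hg.fderiv_self hx, hg.fderiv_self hy] at h1
  have h2 := hg.fderiv_le hx y
  have h3 := hg.fderiv_le hy x
  have h4 : inner ℝ (x - y) x - inner ℝ (x - y) y = ‖x - y‖ ^ 2 := by
    rw [← inner_sub_right, real_inner_self_eq_norm_sq]
  have h5 : s * ‖x - y‖ ^ 2 ≤ 0 := by
    rw [← h4]
    nlinarith [mul_nonneg (norm_nonneg y) (sub_nonneg.2 h2),
      mul_nonneg (norm_nonneg y) (sub_nonneg.2 h3)]
  have h6 : ‖x - y‖ ^ 2 ≤ 0 := by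
    by_contra! h7
    have : 0 < s * ‖x - y‖ ^ 2 := by positivity
    linarith
  exact sub_eq_zero.1
    (norm_eq_zero.1 (pow_eq_zero_iff two_ne_zero |>.1 (le_antisymm h6 (sq_nonneg _))))

/-- The map `x ↦ ‖x‖ ∇g(x) + s x` parametrizes the parallel body `K + s B` by the unit ball. For
surjectivity, a nonzero `v ∈ K + s B` is written as `a` times the gradient of the support function
`g + s ‖·‖` at a unit vector that maximizes `⟪·, v⟫ / (g + s ‖·‖)`, where `a` is the maximum. -/
theorem image_radialGradient_add_smul (hg : IsC2SupportFunction g K) (hK : Convex ℝ K) {s : ℝ}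
    (hs : 0 < s) {k : E} (hk : k ∈ K) (hks : ‖k‖ < s) :
    (fun x => radialGradient g x + s • x) '' (Metric.closedBall 0 1 \ {0}) =
      (K + s • Metric.closedBall (0 : E) 1) \ {0} := by
  have hpos := fun x hx => hg.add_mul_norm_pos hk hks (x := x) hx
  have hconv : Convex ℝ (K + s • Metric.closedBall (0 : E) 1) :=
    hK.add ((convex_closedBall 0 1).smul s)
  have hzero : (0 : E) ∈ K + s • Metric.closedBall (0 : E) 1 := by
    refine ⟨k, hk, -k, ⟨-(s⁻¹ • k), ?_, ?_⟩, add_neg_cancel k⟩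
    · rw [mem_closedBall_zero_iff, norm_neg, norm_smul, norm_inv, Real.norm_of_nonneg hs.le,
        inv_mul_le_iff₀ hs, mul_one]
      exact hks.le
    · simp [smul_smul, hs.ne']
  ext v
  constructor
  · rintro ⟨x, ⟨hx1, hx : x ≠ 0⟩, rfl⟩
    have hx0 : 0 < ‖x‖ := norm_pos_iff.2 hx
    refine ⟨?_, fun h => ?_⟩
    · have h1 : radialGradient g x + s • x = ‖x‖ • (∇ g x + s • (‖x‖⁻¹ • x)) := by
        rw [radialGradient, smul_add, smul_comm ‖x‖ s, smul_inv_smul₀ hx0.ne']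
      simp only [h1]
      refine hconv.smul_mem_of_zero_mem hzero ?_ ⟨hx0.le, mem_closedBall_zero_iff.1 hx1⟩
      refine add_mem_add (hg.gradient_mem x hx) (smul_mem_smul_set ?_)
      rw [mem_closedBall_zero_iff]
      exact (norm_smul_inv_norm hx).le
    · have h1 := congrArg (inner ℝ x) (show radialGradient g x + s • x = 0 from h)
      simp only [inner_add_right, inner_smul_right, IsC2Homogeneous.inner_radialGradient,
        hg.fderiv_self hx, real_inner_self_eq_norm_sq, inner_zero_right] at h1
      have := mul_pos hx0 (hpos x hx)
      nlinarith
  · rintro ⟨⟨k', hk', b', ⟨b, hb, rfl⟩, rfl⟩, hv0⟩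
    set v := k' + s • b
    have hv : v ≠ 0 := hv0
    let F : E → ℝ := fun ω => inner ℝ ω v / (g ω + s * ‖ω‖)
    have hne : ∀ ω ∈ Metric.sphere (0 : E) 1, ω ≠ 0 := fun ω hω =>
      Metric.ne_of_mem_sphere hω one_ne_zero
    have hF : ContinuousOn F (Metric.sphere 0 1) := by
      intro ω hω
      refine ContinuousAt.continuousWithinAt (ContinuousAt.div (by fun_prop) ?_
        (hpos ω (hne ω hω)).ne')
      exact (hg.contDiffAt (hne ω hω)).continuousAt.add (by fun_prop)
    have hvs : ‖v‖⁻¹ • v ∈ Metric.sphere (0 : E) 1 := by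
      rw [mem_sphere_zero_iff_norm]
      exact norm_smul_inv_norm hv
    obtain ⟨ω, hω, hmax⟩ := (isCompact_sphere (0 : E) 1).exists_isMaxOn ⟨_, hvs⟩ hF
    have hω0 := hne ω hω
    have hω1 : ‖ω‖ = 1 := mem_sphere_zero_iff_norm.1 hω
    set a : ℝ := F ω with ha
    have ha0 : 0 < a := by
      refine lt_of_lt_of_le (div_pos ?_ (hpos _ (hne _ hvs))) (hmax hvs)
      rw [real_inner_smul_left, real_inner_self_eq_norm_sq]
      have : 0 < ‖v‖ := norm_pos_iff.2 hv
      positivity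
    have ha1 : a ≤ 1 := by
      rw [ha]
      refine (div_le_one (hpos ω hω0)).2 ?_
      rw [inner_add_right, inner_smul_right]
      have hb1 : ‖b‖ ≤ 1 := mem_closedBall_zero_iff.1 hb
      have h1 : inner ℝ ω b ≤ ‖ω‖ := (real_inner_le_norm ω b).trans
        (mul_le_of_le_one_right (norm_nonneg _) hb1)
      exact add_le_add (hg.inner_le k' hk' ω) (mul_le_mul_of_nonneg_left h1 hs.le)
    have hle : ∀ y : E, y ≠ 0 → inner ℝ y v ≤ a * (1 * g y + s * ‖y‖) := by
      intro y hy
      have hy0 : 0 < ‖y‖ := norm_pos_iff.2 hy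
      have hys : ‖y‖⁻¹ • y ∈ Metric.sphere (0 : E) 1 := by
        rw [mem_sphere_zero_iff_norm]
        exact norm_smul_inv_norm hy
      have h1 : F (‖y‖⁻¹ • y) ≤ a := hmax hys
      have h2 : F (‖y‖⁻¹ • y) = inner ℝ y v / (g y + s * ‖y‖) := by
        simp only [F]
        rw [real_inner_smul_left, hg.map_smul _ (inv_pos.2 hy0), norm_smul, norm_inv, norm_norm,
          show ‖y‖⁻¹ * g y + s * (‖y‖⁻¹ * ‖y‖) = ‖y‖⁻¹ * (g y + s * ‖y‖) by ring,
          mul_div_mul_left _ _ (inv_ne_zero hy0.ne')]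
      rw [h2, div_le_iff₀ (hpos y hy)] at h1
      rwa [one_mul]
    have heq : inner ℝ ω v = a * (1 * g ω + s * ‖ω‖) := by
      rw [ha, one_mul]
      exact (div_mul_cancel₀ _ (hpos ω hω0).ne').symm
    -- At `ω` the function `a (g + s ‖·‖) - ⟪·, v⟫` vanishes and is minimal.
    have hmin : IsLocalMin (fun y => a * (1 * g y + s * ‖y‖) - innerSL ℝ v y) ω := by
      filter_upwards [isOpen_compl_singleton.mem_nhds hω0] with y hy
      simp only [innerSL_apply_apply, real_inner_comm]
      linarith [hle y hy]
    have hcomb := (hg.const_mul 1).add (isC2Homogeneous_norm.const_mul s)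
    have hd := ((hcomb.differentiableAt hω0).hasFDerivAt.const_mul a).sub
      (innerSL ℝ v).hasFDerivAt
    have hzero' := hmin.hasFDerivAt_eq_zero hd
    have hgrad : a • (∇ g ω + s • ω) = v := by
      have h := hg.gradient_combination 1 s hω0
      rw [hω1, one_smul, inv_one, mul_one] at h
      rw [← h]
      refine ext_inner_right ℝ fun w => ?_
      have h2 := congrArg (fun T : E →L[ℝ] ℝ => T w) hzero'
      simp only [_root_.sub_apply, _root_.smul_apply, smul_eq_mul, innerSL_apply_apply,
        _root_.zero_apply] at h2
      rw [real_inner_smul_left, inner_gradient_left]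
      linarith
    refine ⟨a • ω, ⟨?_, smul_ne_zero ha0.ne' hω0⟩, ?_⟩
    · rw [mem_closedBall_zero_iff, norm_smul, Real.norm_of_nonneg ha0.le, hω1, mul_one]
      exact ha1
    · simp only
      rw [hg.radialGradient_smul a ha0, radialGradient, hω1, one_smul, smul_comm s a, ← smul_add,
        hgrad]

theorem neg_vadd (hg : IsC2SupportFunction g K) (k : E) :
    IsC2SupportFunction (fun y => g y - inner ℝ y k) ((-k) +ᵥ K) where
  contDiffOn := hg.contDiffOn.sub (contDiff_id.inner ℝ contDiff_const).contDiffOn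
  map_smul := fun c hc x => by rw [hg.map_smul c hc, real_inner_smul_left]; ring
  inner_le := by
    rintro _ ⟨v, hv, rfl⟩ y
    have := hg.inner_le v hv y
    simp only [vadd_eq_add, inner_add_right, inner_neg_right]
    linarith
  gradient_mem := fun x hx => by
    refine ⟨_, hg.gradient_mem x hx, ?_⟩
    refine ext_inner_right ℝ fun v => ?_
    have h : HasFDerivAt (fun y => g y - inner ℝ y k) (fderiv ℝ g x - innerSL ℝ k) x := by
      have := (hg.differentiableAt hx).hasFDerivAt.sub (innerSL ℝ k).hasFDerivAt
      refine this.congr_of_eventuallyEq (Eventually.of_forall fun y => ?_)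
      simp [real_inner_comm]
    simp only [vadd_eq_add]
    rw [inner_gradient_left, h.fderiv, inner_add_left, inner_gradient_left, inner_neg_left]
    simp only [_root_.sub_apply, innerSL_apply_apply]
    ring

end IsC2SupportFunction

/-! ### Steiner's formula -/

section Integral

variable {E : Type*} [NormedAddCommGroup E] [InnerProductSpace ℝ E] [FiniteDimensional ℝ E]
  [MeasurableSpace E] [BorelSpace E]

theorem integrableOn_of_homogeneous_zero (μ : Measure E) [μ.IsAddHaarMeasure] {F : E → ℝ}
    (hF : ContinuousOn F {0}ᶜ) (hom : ∀ c : ℝ, 0 < c → ∀ x, F (c • x) = F x) :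
    IntegrableOn F (Metric.closedBall 0 1 \ {0}) μ := by
  have hmeas : MeasurableSet (Metric.closedBall (0 : E) 1 \ {0}) :=
    Metric.isClosed_closedBall.measurableSet.diff (measurableSet_singleton 0)
  obtain ⟨C, hC⟩ := (isCompact_sphere (0 : E) 1).exists_bound_of_continuousOn
    (hF.mono fun x hx => Metric.ne_of_mem_sphere hx one_ne_zero)
  refine IntegrableOn.of_bound ?_ ((hF.mono fun x hx => hx.2).aestronglyMeasurable hmeas) C ?_
  · exact (measure_mono sdiff_subset).trans_lt measure_closedBall_lt_top
  · filter_upwards [ae_restrict_mem hmeas] with x hx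
    have hx0 : x ≠ 0 := hx.2
    rw [← hom ‖x‖⁻¹ (inv_pos.2 (norm_pos_iff.2 hx0)) x]
    refine hC _ ?_
    rw [mem_sphere_zero_iff_norm]
    exact norm_smul_inv_norm hx0

/-- Integrating the polynomials `s ↦ det (A x + s)` over the unit ball, where `A` is the derivative
of the radial gradient map, gives a polynomial in `s`. -/
theorem IsC2Homogeneous.exists_polynomial_integral_det (μ : Measure E) [μ.IsAddHaarMeasure]
    {g : E → ℝ} (hg : IsC2Homogeneous g) :
    ∃ P : Polynomial ℝ, ∀ s : ℝ, P.eval s = ∫ x in Metric.closedBall 0 1 \ {0},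
      (fderiv ℝ (radialGradient g) x + s • ContinuousLinearMap.id ℝ E).det ∂μ := by
  let S : Finset ℕ := Finset.range (Module.finrank ℝ E + 1)
  let D : E → ℝ → ℝ := fun x s =>
    (fderiv ℝ (radialGradient g) x + s • ContinuousLinearMap.id ℝ E).det
  have hinj : InjOn (fun i : ℕ => (i : ℝ)) S := fun i _ j _ h => Nat.cast_injective h
  have hint : ∀ s, IntegrableOn (fun x => D x s) (Metric.closedBall 0 1 \ {0}) μ := by
    refine fun s => integrableOn_of_homogeneous_zero μ ?_ ?_
    · exact ContinuousLinearMap.continuous_det.comp_continuousOn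
        (hg.continuousOn_fderiv_radialGradient.add continuousOn_const)
    · intro c hc x
      simp only [D, hg.fderiv_radialGradient_smul hc]
  -- Lagrange interpolation expresses all values of the polynomial by finitely many.
  have hD : ∀ x s, D x s = ∑ i ∈ S, D x i * (Lagrange.basis S (fun i : ℕ => (i : ℝ)) i).eval s := by
    intro x s
    have hdeg : (-(fderiv ℝ (radialGradient g) x : E →ₗ[ℝ] E)).charpoly.degree < S.card := by
      rw [Polynomial.degree_eq_natDegree (LinearMap.charpoly_monic _).ne_zero,
        LinearMap.charpoly_natDegree]
      rw [Finset.card_range]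
      exact_mod_cast Nat.lt_succ_self _
    have h := congrArg (Polynomial.eval s) (Lagrange.eq_interpolate hinj hdeg)
    simp only [D, ContinuousLinearMap.det_add_smul_id_eq_eval_charpoly]
    rw [h, Lagrange.interpolate_apply, Polynomial.eval_finsetSum]
    simp
  refine ⟨∑ i ∈ S, Polynomial.C (∫ x in Metric.closedBall 0 1 \ {0}, D x i ∂μ) *
    Lagrange.basis S (fun i : ℕ => (i : ℝ)) i, fun s => ?_⟩
  calc _ = ∑ i ∈ S, ∫ x in Metric.closedBall 0 1 \ {0},
        D x i * (Lagrange.basis S (fun i : ℕ => (i : ℝ)) i).eval s ∂μ := by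
        rw [Polynomial.eval_finsetSum]
        refine Finset.sum_congr rfl fun i _ => ?_
        rw [integral_mul_const]
        simp
    _ = ∫ x in Metric.closedBall 0 1 \ {0}, D x s ∂μ := by
        simp only [hD _ s]
        exact (integral_finsetSum S fun i _ => (hint i).mul_const _).symm

namespace IsC2SupportFunction

variable {g : E → ℝ} {K : Set E}

/-- Steiner's formula for those `s` for which `K + s B` contains the origin in its interior: the
area formula for the parametrization of `K + s B` by the unit ball. -/
theorem measureReal_add_smul_closedBall_of_norm_lt [Nontrivial E] (μ : Measure E)
    [μ.IsAddHaarMeasure] (hg : IsC2SupportFunction g K) (hK : Convex ℝ K) {s : ℝ} (hs : 0 < s)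
    {k : E} (hk : k ∈ K) (hks : ‖k‖ < s) :
    μ.real (K + s • Metric.closedBall (0 : E) 1) = ∫ x in Metric.closedBall 0 1 \ {0},
      (fderiv ℝ (radialGradient g) x + s • ContinuousLinearMap.id ℝ E).det ∂μ := by
  have hpos := fun x hx => hg.add_mul_norm_pos hk hks (x := x) hx
  have hmeas : MeasurableSet (Metric.closedBall (0 : E) 1 \ {0}) :=
    Metric.isClosed_closedBall.measurableSet.diff (measurableSet_singleton 0)
  have h := integral_image_eq_integral_abs_det_fderiv_smul μ hmeas
    (fun x hx => ((hg.hasFDerivAt_radialGradient hx.2).add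
      ((hasFDerivAt_id x).const_smul s)).hasFDerivWithinAt)
    ((hg.injOn_radialGradient_add_smul hs hpos).mono fun x hx => hx.2) (fun _ => (1 : ℝ))
  have himg := hg.image_radialGradient_add_smul hK hs hk hks
  have h' : ∫ x in (K + s • Metric.closedBall (0 : E) 1) \ {0}, (1 : ℝ) ∂μ =
      ∫ x in Metric.closedBall 0 1 \ {0},
        |(fderiv ℝ (radialGradient g) x + s • ContinuousLinearMap.id ℝ E).det| • (1 : ℝ) ∂μ := by
    rw [← himg]
    exact h
  rw [setIntegral_const, smul_eq_mul, mul_one] at h'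
  have hdiff : μ.real ((K + s • Metric.closedBall (0 : E) 1) \ {0}) =
      μ.real (K + s • Metric.closedBall (0 : E) 1) := by
    rw [measureReal_def, measureReal_def, measure_sdiff_null (measure_singleton 0)]
  rw [← hdiff, h']
  refine setIntegral_congr_fun hmeas fun x hx => ?_
  simp only [smul_eq_mul, mul_one]
  exact abs_of_pos (hg.det_fderiv_radialGradient_pos hs hx.2 (hpos x hx.2))

/-- Steiner's formula, with the Steiner polynomial given as an integral over the unit ball.
Translating `K` so that it contains the origin gives a polynomial that is right for all `s > 0`;
it is the polynomial that belongs to `K` itself because both are right for large `s`. -/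
theorem measureReal_add_smul_closedBall [Nontrivial E] (μ : Measure E) [μ.IsAddHaarMeasure]
    (hg : IsC2SupportFunction g K) (hK : Convex ℝ K) (hKc : IsCompact K) (hKn : K.Nonempty)
    {s : ℝ} (hs : 0 ≤ s) :
    μ.real (K + s • Metric.closedBall (0 : E) 1) = ∫ x in Metric.closedBall 0 1 \ {0},
      (fderiv ℝ (radialGradient g) x + s • ContinuousLinearMap.id ℝ E).det ∂μ := by
  obtain ⟨k, hk⟩ := hKn
  have hg' := hg.neg_vadd k
  obtain ⟨P, hP⟩ := hg.exists_polynomial_integral_det μ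
  obtain ⟨Q, hQ⟩ := hg'.exists_polynomial_integral_det μ
  have hvol : ∀ t : ℝ, 0 < t → μ.real (K + t • Metric.closedBall (0 : E) 1) = Q.eval t := by
    intro t ht
    rw [hQ, ← hg'.measureReal_add_smul_closedBall_of_norm_lt μ (hK.vadd _) ht (k := 0)
      ⟨k, hk, by simp⟩ (by simpa using ht), vadd_add_assoc, measureReal_def, measureReal_def,
      measure_vadd]
  have hPQ : P = Q := by
    refine Polynomial.eq_of_infinite_eval_eq _ _ ((Ioi_infinite ‖k‖).mono fun t ht => ?_)
    have ht0 : 0 < t := (norm_nonneg k).trans_lt ht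
    exact ((hP t).trans (hg.measureReal_add_smul_closedBall_of_norm_lt μ hK ht0 hk ht).symm).trans
      (hvol t ht0)
  rw [← hP, hPQ]
  rcases hs.eq_or_lt with rfl | hs
  · -- The case `s = 0` follows by continuity of the volume from above.
    have hcth : ∀ t : ℝ, 0 < t →
        K + t • Metric.closedBall (0 : E) 1 = Metric.cthickening t K := by
      intro t ht
      rw [← hKc.add_closedBall_zero ht.le, smul_unitClosedBall_of_nonneg ht.le]
    have h1 : Tendsto (fun t => μ.real (Metric.cthickening t K)) (𝓝[>] 0) (𝓝 (μ.real K)) :=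
      ((ENNReal.tendsto_toReal hKc.measure_lt_top.ne).comp
        (tendsto_measure_cthickening_of_isCompact hKc)).mono_left nhdsWithin_le_nhds
    have h2 : Tendsto (fun t => Q.eval t) (𝓝[>] 0) (𝓝 (Q.eval 0)) :=
      (Q.continuous.tendsto 0).mono_left nhdsWithin_le_nhds
    have h3 : (fun t => μ.real (Metric.cthickening t K)) =ᶠ[𝓝[>] 0] fun t => Q.eval t := by
      filter_upwards [self_mem_nhdsWithin] with t ht
      rw [← hcth t ht, hvol t ht]
    rw [zero_smul_set ⟨0, by simp⟩, add_zero]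
    exact tendsto_nhds_unique (h1.congr' h3) h2
  · exact hvol s hs

end IsC2SupportFunction

end Integral

/-! ### Convex bodies and their support functions -/

section Bodies

variable {n : ℕ}

theorem bddAbove_inner_image (K : ConvexBody (EuclideanSpace ℝ (Fin n)))
    (x : EuclideanSpace ℝ (Fin n)) :
    BddAbove ((fun v => inner ℝ x v) '' (K : Set (EuclideanSpace ℝ (Fin n)))) :=
  (K.isCompact.image (by fun_prop)).bddAbove

theorem isC2Homogeneous_supportFn {K : ConvexBody (EuclideanSpace ℝ (Fin n))} (hK : IsC2Body K) :
    IsC2Homogeneous (supportFn K) where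
  contDiffOn := hK
  map_smul := fun c hc x => by
    rw [supportFn, supportFn, ← smul_eq_mul, ← Real.sSup_smul_of_nonneg hc.le]
    congr 1
    ext r
    simp [mem_smul_set, real_inner_smul_left]

theorem isC2SupportFunction_supportFn {K : ConvexBody (EuclideanSpace ℝ (Fin n))}
    (hK : IsC2Body K) : IsC2SupportFunction (supportFn K) (K : Set (EuclideanSpace ℝ (Fin n))) where
  toIsC2Homogeneous := isC2Homogeneous_supportFn hK
  inner_le := fun v hv y => le_csSup (bddAbove_inner_image K y) ⟨v, hv, rfl⟩
  gradient_mem := fun x hx => by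
    obtain ⟨v, hv, hmax⟩ := K.isCompact.exists_sSup_image_eq K.nonempty
      (f := fun v => inner ℝ x v) (by fun_prop)
    -- The linear function of a maximizing `v` touches the support function from below at `x`.
    have hmin : IsLocalMin (fun y => supportFn K y - innerSL ℝ v y) x := by
      refine Eventually.of_forall fun y => ?_
      have h1 : supportFn K x = inner ℝ x v := hmax
      have h2 : inner ℝ y v ≤ supportFn K y := le_csSup (bddAbove_inner_image K y) ⟨v, hv, rfl⟩
      simp only [innerSL_apply_apply, real_inner_comm _ v]
      linarith
    have hd := ((isC2Homogeneous_supportFn hK).differentiableAt hx).hasFDerivAt.sub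
      (innerSL ℝ v).hasFDerivAt
    have h0 := sub_eq_zero.1 (hmin.hasFDerivAt_eq_zero hd)
    have h1 : ∇ (supportFn K) x = v := by
      refine ext_inner_right ℝ fun w => ?_
      rw [inner_gradient_left, h0, innerSL_apply_apply]
    rw [h1]
    exact hv

/-- A homogeneous function with positive semidefinite tangential Hessians is the support function
of the convex body `{v | ∀ y, ⟪y, v⟫ ≤ g y}`. -/
theorem exists_convexBody_supportFn_eq (hn : 2 ≤ n) {g : EuclideanSpace ℝ (Fin n) → ℝ}
    (hg : IsC2Homogeneous g)
    (htan : ∀ ω u : EuclideanSpace ℝ (Fin n), ‖ω‖ = 1 → inner ℝ ω u = 0 →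
      0 ≤ fderiv ℝ (fderiv ℝ g) ω u u) :
    ∃ L : ConvexBody (EuclideanSpace ℝ (Fin n)), supportFn L = g ∧
      ∀ v, v ∈ L ↔ ∀ y, inner ℝ y v ≤ g y := by
  have hdim : 1 < Module.finrank ℝ (EuclideanSpace ℝ (Fin n)) := by
    rw [finrank_euclideanSpace_fin]
    omega
  have hle := fun x hx => hg.fderiv_apply_le_of_tangential hdim htan (x := x) hx
  have : Nontrivial (EuclideanSpace ℝ (Fin n)) :=
    Module.nontrivial_of_finrank_pos (R := ℝ) (zero_lt_one.trans hdim)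
  obtain ⟨x₀, hx₀⟩ := exists_ne (0 : EuclideanSpace ℝ (Fin n))
  set S : Set (EuclideanSpace ℝ (Fin n)) := {v | ∀ y, inner ℝ y v ≤ g y} with hS
  have hmem : ∀ x, x ≠ 0 → ∇ g x ∈ S := fun x hx y => by
    rw [real_inner_comm, inner_gradient_left]
    exact hle x hx y
  have hconv : Convex ℝ S := by
    rw [hS, ofPred_forall]
    exact convex_iInter fun y => convex_halfSpace_le (innerₛₗ ℝ y).isLinear _
  have hclosed : IsClosed S := by
    rw [hS, ofPred_forall]
    exact isClosed_iInter fun y => isClosed_le (by fun_prop) continuous_const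
  obtain ⟨C, hC⟩ := (isCompact_sphere (0 : EuclideanSpace ℝ (Fin n)) 1).bddAbove_image
    (f := g) fun x hx => (hg.contDiffAt
      (Metric.ne_of_mem_sphere hx one_ne_zero)).continuousAt.continuousWithinAt
  have hbdd : S ⊆ Metric.closedBall 0 (max C 0) := by
    intro v hv
    rw [mem_closedBall_zero_iff]
    rcases eq_or_ne v 0 with rfl | hv0
    · simp
    have hpos : 0 < ‖v‖ := norm_pos_iff.2 hv0
    have h1 := hv (‖v‖⁻¹ • v)
    have h2 : g (‖v‖⁻¹ • v) ≤ C := hC (mem_image_of_mem g (by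
      rw [mem_sphere_zero_iff_norm]
      exact norm_smul_inv_norm hv0))
    rw [real_inner_smul_left, real_inner_self_eq_norm_sq, sq, inv_mul_cancel_left₀ hpos.ne'] at h1
    exact (h1.trans h2).trans (le_max_left _ _)
  refine ⟨⟨S, hconv, (isCompact_closedBall 0 _).of_isClosed_subset hclosed hbdd,
    ⟨_, hmem x₀ hx₀⟩⟩, funext fun x => ?_, fun v => Iff.rfl⟩
  refine IsLUB.csSup_eq (IsGreatest.isLUB ?_) ⟨_, mem_image_of_mem _ (hmem x₀ hx₀)⟩
  refine ⟨?_, ?_⟩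
  · rcases eq_or_ne x 0 with rfl | hx
    · exact ⟨_, hmem x₀ hx₀, by simp [hg.map_zero]⟩
    · refine ⟨_, hmem x hx, ?_⟩
      simp only
      rw [real_inner_comm, inner_gradient_left, hg.fderiv_self hx]
  · rintro _ ⟨v, hv, rfl⟩
    exact hv x

theorem eval_steinerPolynomial (hn : 2 ≤ n) {K : ConvexBody (EuclideanSpace ℝ (Fin n))}
    (hK : IsC2Body K) (s : ℝ) :
    (steinerPolynomial K).eval s = ∫ x in Metric.closedBall 0 1 \ {0},
      (fderiv ℝ (radialGradient (supportFn K)) x +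
        s • ContinuousLinearMap.id ℝ (EuclideanSpace ℝ (Fin n))).det := by
  have : Nontrivial (EuclideanSpace ℝ (Fin n)) := by
    refine Module.nontrivial_of_finrank_pos (R := ℝ) ?_
    rw [finrank_euclideanSpace_fin]
    omega
  obtain ⟨P, hP⟩ := (isC2Homogeneous_supportFn hK).exists_polynomial_integral_det volume
  have hS : IsSteinerPolynomial K P := fun t ht => (hP t).trans
    ((isC2SupportFunction_supportFn hK).measureReal_add_smul_closedBall volume K.convex
      K.isCompact K.nonempty ht).symm
  rw [hS.eq_steinerPolynomial, hP]

/-- If `p_L = a p_K + c ‖·‖` with `a = ±1`, then `S_L(t) = aⁿ S_K(a (t + c))`. For `a = -1` the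
body `L` is the complement of `K` with respect to Minkowski addition in a ball of radius `c`. -/
theorem steinerPolynomial_eq_comp (hn : 2 ≤ n) {K L : ConvexBody (EuclideanSpace ℝ (Fin n))}
    (hK : IsC2Body K) (hL : IsC2Body L) {a c : ℝ} (ha : a * a = 1)
    (hKL : supportFn L = fun x => a * supportFn K x + c * ‖x‖) :
    steinerPolynomial L = Polynomial.C (a ^ n) *
      (steinerPolynomial K).comp (Polynomial.C a * (Polynomial.X + Polynomial.C c)) := by
  refine Polynomial.funext fun s => ?_
  have hmeas : MeasurableSet (Metric.closedBall (0 : EuclideanSpace ℝ (Fin n)) 1 \ {0}) :=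
    Metric.isClosed_closedBall.measurableSet.diff (measurableSet_singleton 0)
  simp only [Polynomial.eval_mul, Polynomial.eval_C, Polynomial.eval_comp, Polynomial.eval_add,
    Polynomial.eval_X]
  rw [eval_steinerPolynomial hn hL, eval_steinerPolynomial hn hK, ← integral_const_mul, hKL]
  refine setIntegral_congr_fun hmeas fun x hx => ?_
  rw [(isC2Homogeneous_supportFn hK).fderiv_radialGradient_combination a c hx.2]
  set A := fderiv ℝ (radialGradient (supportFn K)) x
  have h : a • A + c • ContinuousLinearMap.id ℝ _ + s • ContinuousLinearMap.id ℝ _ =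
      a • (A + (a * (s + c)) • ContinuousLinearMap.id ℝ _) := by
    ext v i
    simp
    linear_combination (-(s + c) * v i) * ha
  rw [h, ContinuousLinearMap.det, ContinuousLinearMap.toLinearMap_smul, LinearMap.det_smul,
    finrank_euclideanSpace_fin]

/-- A bound `a D²p_K ≥ -c₀` for the tangential Hessians, with `a = ±1`, makes `a p_K + c ‖·‖` the
support function of a convex body with interior points for each `c > c₀`, and the stability of the
Steiner polynomial of that body bounds the roots of the Steiner polynomial of `K`. -/
theorem mul_re_le_of_tangential_bound (hn : 2 ≤ n)
    (hstable : ∀ L : ConvexBody (EuclideanSpace ℝ (Fin n)),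
      (interior (L : Set (EuclideanSpace ℝ (Fin n)))).Nonempty →
        IsStablePolynomial (steinerPolynomial L))
    {K : ConvexBody (EuclideanSpace ℝ (Fin n))} (hK : IsC2Body K) {a c₀ : ℝ} (ha : a * a = 1)
    (hbound : ∀ ω u : EuclideanSpace ℝ (Fin n), ‖ω‖ = 1 → inner ℝ ω u = 0 →
      0 ≤ a * fderiv ℝ (fderiv ℝ (supportFn K)) ω u u + c₀ * ‖u‖ ^ 2)
    {z : ℂ} (hz : Polynomial.aeval z (steinerPolynomial K) = 0) : a * z.re ≤ c₀ := by
  have hh := isC2Homogeneous_supportFn hK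
  have hbody : ∀ c, c₀ ≤ c → ∃ L : ConvexBody (EuclideanSpace ℝ (Fin n)),
      (supportFn L = fun x => a * supportFn K x + c * ‖x‖) ∧
        ∀ v, v ∈ L ↔ ∀ y, inner ℝ y v ≤ a * supportFn K y + c * ‖y‖ := by
    refine fun c hc => exists_convexBody_supportFn_eq hn
      ((hh.const_mul a).add (isC2Homogeneous_norm.const_mul c)) fun ω u hω hu => ?_
    rw [hh.fderiv_fderiv_combination a c hω hu, real_inner_self_eq_norm_sq]
    exact (hbound ω u hω hu).trans
      (add_le_add_right (mul_le_mul_of_nonneg_right hc (sq_nonneg _)) _)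
  refine le_of_forall_gt_imp_ge_of_dense fun c hc => ?_
  obtain ⟨L₀, -, hL₀⟩ := hbody c₀ le_rfl
  obtain ⟨L, hL, hLmem⟩ := hbody c hc.le
  have hint : (interior (L : Set (EuclideanSpace ℝ (Fin n)))).Nonempty := by
    obtain ⟨v₀, hv₀⟩ := L₀.nonempty
    refine ⟨v₀, mem_interior.2 ⟨Metric.ball v₀ (c - c₀), fun v hv => (hLmem v).2 fun y => ?_,
      Metric.isOpen_ball, Metric.mem_ball_self (sub_pos.2 hc)⟩⟩
    have h1 := (hL₀ v₀).1 hv₀ y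
    have h2 : inner ℝ y (v - v₀) ≤ ‖y‖ * (c - c₀) := (real_inner_le_norm _ _).trans
      (mul_le_mul_of_nonneg_left (mem_ball_iff_norm.1 hv).le (norm_nonneg y))
    rw [inner_sub_right] at h2
    linarith
  have hLC : IsC2Body L := by
    rw [IsC2Body, hL]
    exact ((hh.const_mul a).add (isC2Homogeneous_norm.const_mul c)).contDiffOn
  have haC : (a : ℂ) * a = 1 := by exact_mod_cast ha
  have hroot : Polynomial.aeval ((a : ℂ) * z - c) (steinerPolynomial L) = 0 := by
    rw [steinerPolynomial_eq_comp hn hK hLC ha hL, map_mul, Polynomial.aeval_comp]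
    have harg : Polynomial.aeval ((a : ℂ) * z - c)
        (Polynomial.C a * (Polynomial.X + Polynomial.C c)) = z := by
      simp [← mul_assoc, haC]
    rw [harg, hz, mul_zero]
  have hre := hstable L hint _ hroot
  simp at hre
  exact hre.le

/-! ### Extremal principal radii of curvature -/

theorem IsPrincipalRadius.exists_fderiv_fderiv_eq {K : ConvexBody (EuclideanSpace ℝ (Fin n))}
    {ω : EuclideanSpace ℝ (Fin n)} {r : ℝ} (h : IsPrincipalRadius K ω r) :
    ∃ u : EuclideanSpace ℝ (Fin n), u ≠ 0 ∧ inner ℝ ω u = 0 ∧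
      fderiv ℝ (fderiv ℝ (supportFn K)) ω u u = r * ‖u‖ ^ 2 := by
  obtain ⟨u, hu, hωu, h⟩ := h
  exact ⟨u, hu, hωu, by rw [h u hωu, real_inner_self_eq_norm_sq]⟩

/-- For `a = 1` the radius found here is the smallest, for `a = -1` the largest value of the
tangential Hessians on unit vectors. It exists by compactness of the set of orthonormal pairs, and
an extremal direction is an eigenvector because a semidefinite form vanishes identically against
its null vectors. -/
theorem exists_extremal_principalRadius (hn : 2 ≤ n)
    {K : ConvexBody (EuclideanSpace ℝ (Fin n))} (hK : IsC2Body K) {a : ℝ} (ha : a ≠ 0) :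
    ∃ ρ ∈ principalRadii K, ∀ ω u : EuclideanSpace ℝ (Fin n), ‖ω‖ = 1 → inner ℝ ω u = 0 →
      0 ≤ a * (fderiv ℝ (fderiv ℝ (supportFn K)) ω u u - ρ * ‖u‖ ^ 2) := by
  have hh := isC2Homogeneous_supportFn hK
  set H := fderiv ℝ (fderiv ℝ (supportFn K)) with hH
  let T : Set (EuclideanSpace ℝ (Fin n) × EuclideanSpace ℝ (Fin n)) :=
    (Metric.sphere 0 1 ×ˢ Metric.sphere 0 1) ∩ {p | inner ℝ p.1 p.2 = 0}
  have hTc : IsCompact T := ((isCompact_sphere _ _).prod (isCompact_sphere _ _)).inter_right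
    (isClosed_eq (by fun_prop) continuous_const)
  have hTn : T.Nonempty := by
    refine ⟨(EuclideanSpace.single ⟨0, by omega⟩ 1, EuclideanSpace.single ⟨1, by omega⟩ 1), ?_⟩
    simp [T, EuclideanSpace.inner_single_left]
  have hHc : ContinuousOn H {0}ᶜ := by
    intro x hx
    exact ((hh.contDiffAt_fderiv hx).fderiv_right (m := 0)
      (by norm_num)).continuousAt.continuousWithinAt
  have hcont : ContinuousOn (fun p : EuclideanSpace ℝ (Fin n) × EuclideanSpace ℝ (Fin n) =>
      a * H p.1 p.2 p.2) T := by
    have h1 : ContinuousOn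
        (fun p : EuclideanSpace ℝ (Fin n) × EuclideanSpace ℝ (Fin n) => H p.1) T :=
      hHc.comp continuousOn_fst fun p hp => Metric.ne_of_mem_sphere hp.1.1 one_ne_zero
    exact continuousOn_const.mul
      ((h1.clm_apply continuousOn_snd).clm_apply continuousOn_snd)
  obtain ⟨⟨ω, u⟩, ⟨⟨hω, hu⟩, hωu⟩, hmin⟩ := hTc.exists_isMinOn hTn hcont
  simp only [mem_sphere_zero_iff_norm] at hω hu
  have hωu : inner ℝ ω u = 0 := hωu
  have hext : ∀ ω' u' : EuclideanSpace ℝ (Fin n), ‖ω'‖ = 1 → inner ℝ ω' u' = 0 →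
      0 ≤ a * (H ω' u' u' - H ω u u * ‖u'‖ ^ 2) := by
    intro ω' u' hω' hu'
    rcases eq_or_ne u' 0 with rfl | hu0
    · simp
    have hpos : 0 < ‖u'‖ := norm_pos_iff.2 hu0
    have hmem : (ω', ‖u'‖⁻¹ • u') ∈ T := by
      refine ⟨⟨mem_sphere_zero_iff_norm.2 hω', mem_sphere_zero_iff_norm.2 ?_⟩, ?_⟩
      · exact norm_smul_inv_norm hu0
      · simp [inner_smul_right, hu']
    have h1 : a * H ω u u ≤ a * H ω' (‖u'‖⁻¹ • u') (‖u'‖⁻¹ • u') := hmin hmem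
    simp only [map_smul, _root_.smul_apply, smul_eq_mul] at h1
    have h2 := mul_le_mul_of_nonneg_right h1 (sq_nonneg ‖u'‖)
    have h3 : a * (‖u'‖⁻¹ * (‖u'‖⁻¹ * H ω' u' u')) * ‖u'‖ ^ 2 = a * H ω' u' u' := by
      field_simp
    rw [h3] at h2
    linarith
  have hω0 : ω ≠ 0 := by
    rintro rfl
    simp at hω
  have hsymm : ∀ v w, H ω v w = H ω w v :=
    ((hh.contDiffAt hω0).isSymmSndFDerivAt (by simp)).eq
  refine ⟨H ω u u, ⟨ω, hω, u, ?_, hωu, fun v hv => ?_⟩, hext⟩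
  · rintro rfl
    simp at hu
  set b : ℝ := a * (H ω u v - H ω u u * inner ℝ u v) with hb
  set q : ℝ := a * (H ω v v - H ω u u * ‖v‖ ^ 2) with hq
  have hq0 : 0 ≤ q := hext ω v hω hv
  have hquad : ∀ t : ℝ, 0 ≤ 2 * t * b + t ^ 2 * q := by
    intro t
    have h1 := hext ω (u + t • v) hω (by rw [inner_add_right, inner_smul_right, hωu, hv]; simp)
    have h2 : ‖u + t • v‖ ^ 2 = 1 + 2 * t * inner ℝ u v + t ^ 2 * ‖v‖ ^ 2 := by
      rw [norm_add_sq_real, hu, inner_smul_right, norm_smul, Real.norm_eq_abs, mul_pow, sq_abs]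
      ring
    rw [h2] at h1
    simp only [map_add, map_smul, _root_.add_apply, _root_.smul_apply, smul_eq_mul,
      hsymm v u] at h1
    rw [hb, hq]
    linarith
  have hb0 : b = 0 := by
    -- This `t` makes the quadratic polynomial negative unless `b = 0`.
    have h1 := hquad (-b / (q + 1))
    have h2 : 2 * (-b / (q + 1)) * b + (-b / (q + 1)) ^ 2 * q =
        -(b ^ 2 * (q + 2)) / (q + 1) ^ 2 := by
      field_simp
      ring
    rw [h2, le_div_iff₀ (by positivity), zero_mul] at h1
    have h3 : b ^ 2 ≤ 0 := by nlinarith [sq_nonneg b]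
    exact pow_eq_zero_iff two_ne_zero |>.1 (le_antisymm h3 (sq_nonneg b))
  have := (mul_eq_zero.1 hb0).resolve_left ha
  linarith

end Bodies

theorem theorem1p2 (n : ℕ) (hn : 2 ≤ n)
    (hstable : ∀ L : ConvexBody (EuclideanSpace ℝ (Fin n)),
      (interior (L : Set (EuclideanSpace ℝ (Fin n)))).Nonempty →
        IsStablePolynomial (steinerPolynomial L))
    (K : ConvexBody (EuclideanSpace ℝ (Fin n))) (hK : IsC2Body K) :
    ∃ ρmin ρmax : ℝ,
      IsLeast (principalRadii K) ρmin ∧ IsGreatest (principalRadii K) ρmax ∧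
        ∀ z : ℂ, Polynomial.aeval z (steinerPolynomial K) = 0 →
          -ρmax ≤ z.re ∧ z.re ≤ -ρmin := by
  obtain ⟨ρmin, hmin, hmin'⟩ := exists_extremal_principalRadius hn hK one_ne_zero
  obtain ⟨ρmax, hmax, hmax'⟩ :=
    exists_extremal_principalRadius hn hK (neg_ne_zero.2 (one_ne_zero (α := ℝ)))
  refine ⟨ρmin, ρmax, ⟨hmin, ?_⟩, ⟨hmax, ?_⟩, fun z hz => ⟨?_, ?_⟩⟩
  · rintro r ⟨ω, hω, hr⟩
    obtain ⟨u, hu, hωu, h⟩ := hr.exists_fderiv_fderiv_eq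
    have h1 := hmin' ω u hω hωu
    rw [h] at h1
    have hpos : 0 < ‖u‖ ^ 2 := pow_pos (norm_pos_iff.2 hu) 2
    exact le_of_mul_le_mul_right (by linarith) hpos
  · rintro r ⟨ω, hω, hr⟩
    obtain ⟨u, hu, hωu, h⟩ := hr.exists_fderiv_fderiv_eq
    have h1 := hmax' ω u hω hωu
    rw [h] at h1
    have hpos : 0 < ‖u‖ ^ 2 := pow_pos (norm_pos_iff.2 hu) 2
    exact le_of_mul_le_mul_right (by linarith) hpos
  · have := mul_re_le_of_tangential_bound hn hstable hK (a := -1) (c₀ := ρmax) (by norm_num)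
      (fun ω u hω hu => by linarith [hmax' ω u hω hu]) hz
    linarith
  · have := mul_re_le_of_tangential_bound hn hstable hK (a := 1) (c₀ := -ρmin) (by norm_num)
      (fun ω u hω hu => by linarith [hmin' ω u hω hu]) hz
    linarith
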